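/- For a metric space $A$ and a Lipschitz function $h:A\to\mathbb{R}$, let $\operatorname{Lip}(h)$ denote its Lipschitz constant, i.e. the least $K\ge 0$ with $|h(a)-h(b)|\le K\,d(a,b)$ for all $a,b\in A$. A real Banach space $X$ is said to have property $(*)$ if there is a constant $C_0$, depending only on $X$, such that for every Lipschitz function $f:X\to\mathbb{R}$ and every $\varepsilon>0$ there is a Lipschitz, $C^1$-smooth function $K:X\to\mathbb{R}$ with $|f(x)-K(x)|<\varepsilon$ for all $x\in X$ and $\operatorname{Lip}(K)\le C_0\operatorname{Lip}(f)$. Here $C^1$-smooth means continuously Fréchet differentiable. **Theorem.** Let $X$ be a real Banach space with property $(*)$. Then there is a constant $C_2\ge 0$, depending only on $X$, such that the following holds. Let $Y\subset X$ be a closed linear subspace, $f:Y\to\mathbb{R}$ a $C^1$-smooth function, $F:X\to\mathbb{R}$ a continuous extension of $f$ (so $F|_Y=f$), and $\varepsilon>0$. Then there exists a $C^1$-smooth function $G:X\to\mathbb{R}$ such that, with $g=G|_Y$, (i) $|F(x)-G(x)|<\varepsilon$ for all $x\in X$, and (ii) $\|f'(y)-g'(y)\|_{Y^*}<\varepsilon$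 for all $y\in Y$. (iii) Furthermore, if $f$ is Lipschitz on $Y$ and $F$ is Lipschitz on $X$, then $G$ satisfying (i) and (ii) can be chosen to be Lipschitz on $X$ as well, with $\operatorname{Lip}(G)\le C_2\operatorname{Lip}(F)$. -/

import Mathlib

open scoped NNReal

/-- A real-valued function is Lipschitz if it is `K`-Lipschitz for some finite constant `K`. -/
def IsLipschitz {α : Type*} [PseudoMetricSpace α] (f : α → ℝ) : Prop :=
  ∃ K : ℝ≥0, LipschitzWith K f

/-- The Lipschitz constant `Lip(f)`: the least `K` such that `f` is `K`-Lipschitz.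
It is meaningful for Lipschitz `f` only (the infimum is then attained, see
`IsLipschitz.lipschitzWith_lipConst`). -/
noncomputable def lipConst {α : Type*} [PseudoMetricSpace α] (f : α → ℝ) : ℝ≥0 :=
  sInf {K : ℝ≥0 | LipschitzWith K f}

theorem IsLipschitz.lipschitzWith_lipConst {α : Type*} [PseudoMetricSpace α] {f : α → ℝ}
    (hf : IsLipschitz f) : LipschitzWith (lipConst f) f := by
  have hc : IsClosed {K : ℝ≥0 | LipschitzWith K f} := by
    have : {K : ℝ≥0 | LipschitzWith K f} =
        ⋂ x : α, ⋂ y : α, {K : ℝ≥0 | dist (f x) (f y) ≤ (K : ℝ) * dist x y} := by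
      ext K
      simp [lipschitzWith_iff_dist_le_mul]
    rw [this]
    refine isClosed_iInter fun x => isClosed_iInter fun y => ?_
    exact isClosed_le continuous_const (by fun_prop)
  exact hc.csInf_mem hf (OrderBot.bddBelow _)

theorem lipConst_le {α : Type*} [PseudoMetricSpace α] {f : α → ℝ} {K : ℝ≥0}
    (hf : LipschitzWith K f) : lipConst f ≤ K :=
  csInf_le (OrderBot.bddBelow _) hf

/-- Property (*) of a real normed space `X`: there is a constant `C₀`, depending only on `X`,
such that every Lipschitz `f : X → ℝ` is, for each `ε > 0`, uniformly `ε`-approximated by a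
Lipschitz, `C¹`-smooth function `K : X → ℝ` with `Lip(K) ≤ C₀ Lip(f)`. -/
def PropertyStar (X : Type*) [NormedAddCommGroup X] [NormedSpace ℝ X] : Prop :=
  ∃ C₀ : ℝ≥0, ∀ f : X → ℝ, IsLipschitz f → ∀ ε : ℝ, 0 < ε →
    ∃ K : X → ℝ, IsLipschitz K ∧ ContDiff ℝ 1 K ∧
      (∀ x : X, |f x - K x| < ε) ∧ lipConst K ≤ C₀ * lipConst f

/-! Near a point of `Y`, extend the derivative of `f` by Hahn–Banach to a functional `T`. The
remainder `f - T` has small Lipschitz constant on a ball of `Y`; extend it to `X` with the same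
constant and smooth it by property (*). Adding `T` back gives a `C¹` function with nearly the right
derivative along `Y` and arbitrarily small error on `Y`. Off `Y`, constants suffice.

`PropertyStar.exists_contDiff_glue` joins such pieces by a partition of unity with one derivative
bound per level. The accuracy of each level is chosen after that bound, so differentiating the
weights costs at most `ε`; convexity does the rest.

The resulting `G₁` has controlled derivative on `Y` only. For (iii), `G₁` is clamped to a thin band
around a small Lipschitz perturbation of `F` that agrees with `G₁` on `Y`. The band closes where the
derivative of `G₁` is large, so the clamped function is Lipschitz, and it still equals `G₁` near
`Y`. Gluing `G₁` near `Y` to property (*) approximations of the clamped function elsewhere gives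
`G`. -/

open Set Filter Topology

/-! ### Smooth bumps and partitions of unity -/

section Gluing

variable {X : Type*} [NormedAddCommGroup X] [NormedSpace ℝ X]

/-- Property (*) with explicit Lipschitz constants. -/
theorem PropertyStar.exists_approx (hX : PropertyStar X) :
    ∃ C₀ : ℝ≥0, ∀ (f : X → ℝ) (L : ℝ≥0), LipschitzWith L f → ∀ ε : ℝ, 0 < ε →
      ∃ K : X → ℝ, ContDiff ℝ 1 K ∧ (∀ x, |K x - f x| < ε) ∧ LipschitzWith (C₀ * L) K := by
  obtain ⟨C₀, hC⟩ := hX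
  refine ⟨C₀, fun f L hf ε hε => ?_⟩
  obtain ⟨K, hK, hK1, hKf, hKL⟩ := hC f ⟨L, hf⟩ ε hε
  refine ⟨K, hK1, fun x => by rw [abs_sub_comm]; exact hKf x, ?_⟩
  exact hK.lipschitzWith_lipConst.weaken
    (hKL.trans (mul_le_mul_right (lipConst_le hf) _))

/-- Smooth the distance to `A` within `r / 8` and compose with a one-dimensional bump. -/
theorem PropertyStar.exists_bump (hX : PropertyStar X) (A : Set X) {r : ℝ} (hr : 0 < r) :
    ∃ b : X → ℝ, ContDiff ℝ 1 b ∧ (∀ x, 0 ≤ b x) ∧ (∀ x, b x ≤ 1) ∧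
      (∃ M : ℝ, ∀ x, ‖fderiv ℝ b x‖ ≤ M) ∧ (∀ a ∈ A, ∀ᶠ x in 𝓝 a, b x = 1) ∧
      tsupport b ⊆ Metric.thickening r A := by
  rcases A.eq_empty_or_nonempty with rfl | hA
  · refine ⟨fun _ => 0, contDiff_const, by simp, by simp, ⟨0, by simp⟩, by simp, ?_⟩
    simp [tsupport, Function.support]
  obtain ⟨C₀, hC⟩ := hX.exists_approx
  obtain ⟨K, hK1, hKf, hKL⟩ :=
    hC (fun x => Metric.infDist x A) 1 (Metric.lipschitz_infDist_pt A) (r / 8) (by positivity)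
  let θ : ContDiffBump (0 : ℝ) := ⟨r / 4, 3 * r / 8, by positivity, by linarith⟩
  have hθ : ContDiff ℝ 1 (θ : ℝ → ℝ) := θ.contDiff
  obtain ⟨M, hM⟩ := ContDiff.lipschitzWith_of_hasCompactSupport θ.hasCompactSupport hθ (by simp)
  have hb : LipschitzWith (M * (C₀ * 1)) (fun x => θ (K x)) := hM.comp hKL
  refine ⟨fun x => θ (K x), hθ.comp hK1, fun x => θ.nonneg, fun x => θ.le_one,
    ⟨_, fun x => norm_fderiv_le_of_lipschitz ℝ hb⟩, fun a ha => ?_, ?_⟩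
  · have hcont : Continuous fun x => Metric.infDist x A := Metric.continuous_infDist_pt A
    have h0 : Metric.infDist a A < r / 8 := by
      rw [Metric.infDist_zero_of_mem ha]; positivity
    filter_upwards [hcont.continuousAt.eventually_lt continuousAt_const h0] with x hx
    apply θ.one_of_mem_closedBall
    have h1 := abs_lt.1 (hKf x)
    have h2 : 0 ≤ Metric.infDist x A := Metric.infDist_nonneg
    rw [Metric.mem_closedBall, Real.dist_eq, sub_zero]
    change |K x| ≤ r / 4
    rw [abs_le]
    constructor <;> linarith
  · have hcl : IsClosed {x | Metric.infDist x A ≤ r / 2} :=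
      isClosed_le (Metric.continuous_infDist_pt A) continuous_const
    refine (closure_minimal ?_ hcl).trans fun x hx => ?_
    · intro x hx
      by_contra hcon
      apply hx
      apply θ.zero_of_le_dist
      rw [mem_ofPred_eq, not_le] at hcon
      have h1 := abs_lt.1 (hKf x)
      rw [Real.dist_eq, sub_zero]
      change 3 * r / 8 ≤ |K x|
      exact le_trans (by linarith) (le_abs_self _)
    · rw [Metric.mem_thickening_iff_infDist_lt hA]
      exact lt_of_le_of_lt hx (by linarith)

/-- A countable family of bumps equal to one on a neighbourhood of each point gives a locally
finite partition of unity whose members have bounded derivatives. -/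
theorem exists_partition_of_bumps {b : ℕ → X → ℝ} (hb : ∀ n, ContDiff ℝ 1 (b n))
    (h0 : ∀ n x, 0 ≤ b n x) (h1 : ∀ n x, b n x ≤ 1)
    (hM : ∀ n, ∃ M : ℝ, ∀ x, ‖fderiv ℝ (b n) x‖ ≤ M)
    (hcov : ∀ x, ∃ n, ∀ᶠ z in 𝓝 x, b n z = 1) :
    ∃ l : ℕ → X → ℝ, (∀ n, ContDiff ℝ 1 (l n)) ∧ (∀ n x, 0 ≤ l n x) ∧
      (∀ n x, b n x = 0 → l n x = 0) ∧
      (∃ M : ℕ → ℝ, ∀ n x, ‖fderiv ℝ (l n) x‖ ≤ M n) ∧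
      ∀ x, ∃ N, ∀ᶠ z in 𝓝 x, (∀ n, N ≤ n → l n z = 0) ∧ ∑ n ∈ Finset.range N, l n z = 1 := by
  -- The weights `w n - w (n + 1) = b n * w n` telescope, and `w n` vanishes past the first bump
  -- equal to one.
  let w : ℕ → X → ℝ := fun n x => ∏ m ∈ Finset.range n, (1 - b m x)
  have hws : ∀ n x, w (n + 1) x = w n x * (1 - b n x) := fun n x => Finset.prod_range_succ _ _
  have hw1 : ∀ n, ContDiff ℝ 1 (w n) := fun n =>
    contDiff_prod fun m _ => contDiff_const.sub (hb m)
  have hwd : ∀ n, Differentiable ℝ (w n) := fun n => (hw1 n).differentiable (by simp)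
  have hbd : ∀ n, Differentiable ℝ (b n) := fun n => (hb n).differentiable (by simp)
  have hwnn : ∀ n x, 0 ≤ w n x := fun n x =>
    Finset.prod_nonneg fun m _ => by linarith [h1 m x]
  have hwle : ∀ n x, w n x ≤ 1 := fun n x =>
    Finset.prod_le_one (fun m _ => by linarith [h1 m x]) fun m _ => by linarith [h0 m x]
  have hwM : ∀ n, ∃ M : ℝ, ∀ x, ‖fderiv ℝ (w n) x‖ ≤ M := by
    intro n
    induction n with
    | zero => exact ⟨0, fun x => by simp [w]⟩
    | succ n ih =>
      obtain ⟨M, hM'⟩ := ih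
      obtain ⟨M₁, hM₁⟩ := hM n
      refine ⟨M₁ + M, fun x => ?_⟩
      have : HasFDerivAt (w (n + 1))
          (w n x • (-(fderiv ℝ (b n) x)) + (1 - b n x) • fderiv ℝ (w n) x) x := by
        have h := (hwd n x).hasFDerivAt.mul ((hbd n x).hasFDerivAt.const_sub 1)
        exact h.congr_of_eventuallyEq (Eventually.of_forall fun z => hws n z)
      rw [this.fderiv]
      refine (norm_add_le _ _).trans (add_le_add ?_ ?_)
      · rw [norm_smul, norm_neg, Real.norm_of_nonneg (hwnn n x)]
        exact (mul_le_of_le_one_left (norm_nonneg _) (hwle n x)).trans (hM₁ x)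
      · rw [norm_smul, Real.norm_of_nonneg (by linarith [h1 n x])]
        exact (mul_le_of_le_one_left (norm_nonneg _) (by linarith [h0 n x])).trans (hM' x)
  choose M hM' using hwM
  refine ⟨fun n x => w n x - w (n + 1) x, fun n => (hw1 n).sub (hw1 (n + 1)), fun n x => ?_,
    fun n x hx => ?_, ⟨fun n => M n + M (n + 1), fun n x => ?_⟩, fun x => ?_⟩
  · change 0 ≤ w n x - w (n + 1) x
    rw [hws]
    nlinarith [hwnn n x, h0 n x]
  · simp [hws, hx]
  · rw [fderiv_fun_sub (hwd n x) (hwd (n + 1) x)]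
    exact (norm_sub_le _ _).trans (add_le_add (hM' n x) (hM' (n + 1) x))
  · obtain ⟨m, hm⟩ := hcov x
    refine ⟨m + 1, ?_⟩
    filter_upwards [hm] with z hz
    have hz0 : ∀ n, m + 1 ≤ n → w n z = 0 := fun n hn =>
      Finset.prod_eq_zero (Finset.mem_range.2 hn) (by rw [hz, sub_self])
    refine ⟨fun n hn => ?_, ?_⟩
    · rw [hz0 n hn, hz0 (n + 1) (by omega), sub_self]
    · rw [Finset.sum_range_sub', hz0 (m + 1) le_rfl]
      simp [w]

end Gluing

/-- The `σ`-discrete refinement underlying Stone's theorem: the centres at level `n` with different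
indices are at distance at least `3 * (1 / 2) ^ n`. -/
theorem exists_sigmaDiscrete_centers {X : Type*} [PseudoMetricSpace X] (U : X → Set X)
    (hU : ∀ x, IsOpen (U x)) (hx : ∀ x, x ∈ U x) :
    ∃ (ind : X → X) (A : ℕ → Set X), (∀ x, ∃ n, x ∈ A n) ∧
      (∀ n, ∀ c ∈ A n, Metric.ball c (3 * (1 / 2) ^ n) ⊆ U (ind c)) ∧
      ∀ n, ∀ c ∈ A n, ∀ c' ∈ A n, dist c c' < 3 * (1 / 2) ^ n → ind c = ind c' := by
  have wf : WellFounded (WellOrderingRel : X → X → Prop) := WellOrderingRel.isWellOrder.wf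
  -- The least index of a set containing `x`: if two nearby centres had different indices, the ball
  -- of the one with the smaller index would contradict minimality at the other.
  let ind : X → X := fun x => wf.min {i | x ∈ U i} ⟨x, hx x⟩
  have hind : ∀ x, x ∈ U (ind x) := fun x => wf.min_mem {i | x ∈ U i} ⟨x, hx x⟩
  have hnot : ∀ x i, WellOrderingRel i (ind x) → x ∉ U i := fun x i hi hxi =>
    wf.not_lt_min {i | x ∈ U i} hxi hi
  refine ⟨ind, fun n => {c | Metric.ball c (3 * (1 / 2) ^ n) ⊆ U (ind c)}, fun x => ?_,
    fun n c hc => hc, fun n c hc c' hc' hd => ?_⟩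
  · obtain ⟨δ, hδ, hball⟩ := Metric.isOpen_iff.1 (hU (ind x)) x (hind x)
    obtain ⟨n, hn⟩ := exists_pow_lt_of_lt_one (show 0 < δ / 3 by positivity)
      (show (1 / 2 : ℝ) < 1 by norm_num)
    exact ⟨n, (Metric.ball_subset_ball (by linarith)).trans hball⟩
  · rcases trichotomous_of WellOrderingRel (ind c) (ind c') with h | h | h
    · exact absurd (hc (by rwa [Metric.mem_ball, dist_comm])) (hnot c' _ h)
    · exact h
    · exact absurd (hc' (by rwa [Metric.mem_ball])) (hnot c _ h)

/-! ### Gluing local approximations -/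

section Gluing

variable {X : Type*} [NormedAddCommGroup X] [NormedSpace ℝ X]

/-- Local `C¹` approximations of `F` whose derivatives on `S` lie in prescribed convex sets can be
glued to a global one, provided that they are arbitrarily good on `S`. -/
theorem PropertyStar.exists_contDiff_glue (hX : PropertyStar X) {F : X → ℝ} {S : Set X}
    {Q : X → Set (X →L[ℝ] ℝ)} (hQ : ∀ z, Convex ℝ (Q z)) {ε : ℝ} (hε : 0 < ε)
    (H : ∀ x, ∃ U : Set X, IsOpen U ∧ x ∈ U ∧ ∀ τ : ℝ, 0 < τ → ∃ p : X → ℝ, ContDiff ℝ 1 p ∧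
      (∀ z ∈ U, |p z - F z| < ε) ∧ ∀ z ∈ U, z ∈ S → |p z - F z| ≤ τ ∧ fderiv ℝ p z ∈ Q z) :
    ∃ G : X → ℝ, ContDiff ℝ 1 G ∧ (∀ z, |G z - F z| < ε) ∧
      ∀ z ∈ S, ∃ q ∈ Q z, ‖fderiv ℝ G z - q‖ ≤ ε := by
  classical
  choose U hU hxU H using H
  choose! p hp1 hpF hpS using H
  obtain ⟨ind, A, hcov, hball, hsep⟩ := exists_sigmaDiscrete_centers U hU hxU
  have hr : ∀ n : ℕ, (0 : ℝ) < (1 / 2) ^ n := fun n => by positivity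
  choose b hb1 hb0 hble hbM hbA hbO using fun n => hX.exists_bump (A n) (hr n)
  obtain ⟨l, hl1, hl0, hlb, ⟨M, hM⟩, hlN⟩ := exists_partition_of_bumps hb1 hb0 hble hbM
    fun x => (hcov x).imp fun n hn => hbA n x hn
  -- Makes `τ n * M n` at most the `n`-th term of a geometric series with sum `ε`.
  let τ : ℕ → ℝ := fun n => ε * (1 / 2) ^ n / (2 * (|M n| + 1))
  have hτ : ∀ n, 0 < τ n := fun n => by positivity
  have hτM : ∀ n, τ n * M n ≤ ε / 2 * (1 / 2) ^ n := fun n => by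
    have h : τ n * (|M n| + 1) = ε / 2 * (1 / 2) ^ n := by
      simp only [τ]
      field_simp
    rw [← h]
    exact mul_le_mul_of_nonneg_left (by linarith [le_abs_self (M n)]) (hτ n).le
  have hc : ∀ n x, ∃ c, x ∈ Metric.thickening ((1 / 2) ^ n) (A n) →
      c ∈ A n ∧ dist x c < (1 / 2) ^ n := fun n x => by
    by_cases h : x ∈ Metric.thickening ((1 / 2) ^ n) (A n)
    · obtain ⟨c, hc⟩ := Metric.mem_thickening_iff.1 h
      exact ⟨c, fun _ => hc⟩
    · exact ⟨x, fun h' => absurd h' h⟩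
  choose c hc using hc
  let O : ℕ → Set X := fun n => Metric.thickening ((1 / 2) ^ n) (A n)
  let j : ℕ → X → X := fun n x => ind (c n x)
  have hjU : ∀ n x, x ∈ O n → x ∈ U (j n x) := fun n x hx =>
    hball n _ (hc n x hx).1 (Metric.ball_subset_ball (by linarith [hr n]) (hc n x hx).2)
  have hjloc : ∀ n x, x ∈ O n → ∀ᶠ z in 𝓝 x, j n z = j n x := fun n x hx => by
    filter_upwards [Metric.isOpen_thickening.mem_nhds hx, Metric.ball_mem_nhds x (hr n)] with z hz hzx
    apply hsep n _ (hc n z hz).1 _ (hc n x hx).1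
    have h1 := (hc n z hz).2
    have h2 := (hc n x hx).2
    rw [Metric.mem_ball] at hzx
    calc dist (c n z) (c n x) ≤ dist (c n z) z + dist z x + dist x (c n x) := dist_triangle4 _ _ _ _
      _ < 3 * (1 / 2) ^ n := by rw [dist_comm (c n z) z]; linarith
  have hlO : ∀ n x, x ∉ O n → ∀ᶠ z in 𝓝 x, l n z = 0 := fun n x hx => by
    filter_upwards [notMem_tsupport_iff_eventuallyEq.1 fun h => hx (hbO n h)] with z hz
    exact hlb n z hz
  -- The centre `c n x` is an arbitrary choice, but its index is locally constant on `O n`, and `l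
  -- n` vanishes near every point outside; hence `T n` is smooth.
  let T : ℕ → X → ℝ := fun n x => l n x * p (j n x) (τ n) x
  have hTin : ∀ n x, x ∈ O n → T n =ᶠ[𝓝 x] fun z => l n z * p (j n x) (τ n) z := fun n x hx => by
    filter_upwards [hjloc n x hx] with z hz
    simp only [T, hz]
  have hTout : ∀ n x, x ∉ O n → T n =ᶠ[𝓝 x] fun _ => 0 := fun n x hx => by
    filter_upwards [hlO n x hx] with z hz
    simp only [T, hz, zero_mul]
  have hT1 : ∀ n, ContDiff ℝ 1 (T n) := fun n => contDiff_iff_contDiffAt.2 fun x => by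
    by_cases hx : x ∈ O n
    · exact ((hl1 n).mul (hp1 _ _ (hτ n))).contDiffAt.congr_of_eventuallyEq (hTin n x hx)
    · exact contDiffAt_const.congr_of_eventuallyEq (hTout n x hx)
  let G : X → ℝ := fun x => ∑' n, T n x
  have hGloc : ∀ x N, (∀ᶠ z in 𝓝 x, (∀ n, N ≤ n → l n z = 0) ∧ ∑ n ∈ Finset.range N, l n z = 1) →
      G =ᶠ[𝓝 x] fun z => ∑ n ∈ Finset.range N, T n z := fun x N h => by
    filter_upwards [h] with z hz
    refine tsum_eq_sum fun n hn => ?_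
    simp only [T, hz.1 n (by simpa using hn), zero_mul]
  refine ⟨G, contDiff_iff_contDiffAt.2 fun x => ?_, fun x => ?_, fun x hxS => ?_⟩
  · obtain ⟨N, hN⟩ := hlN x
    exact (ContDiff.sum fun n _ => hT1 n).contDiffAt.congr_of_eventuallyEq (hGloc x N hN)
  · obtain ⟨N, hN⟩ := hlN x
    -- Off `O n` the weight is zero; the default only has to lie in the convex set.
    let a : ℕ → ℝ := fun n => if x ∈ O n then p (j n x) (τ n) x else F x
    have ha : ∀ n, a n ∈ Metric.ball (F x) ε := fun n => by
      by_cases hx : x ∈ O n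
      · simp only [a, hx, if_true, Metric.mem_ball, Real.dist_eq]
        exact hpF _ _ (hτ n) _ (hjU n x hx)
      · simp only [a, hx, if_false]
        exact Metric.mem_ball_self hε
    have hmem := (convex_ball (F x) ε).sum_mem (t := Finset.range N) (w := fun n => l n x)
      (fun n _ => hl0 n x) hN.self_of_nhds.2 (fun n _ => ha n)
    have hGx : G x = ∑ n ∈ Finset.range N, l n x • a n := by
      rw [(hGloc x N hN).self_of_nhds]
      refine Finset.sum_congr rfl fun n _ => ?_
      by_cases hx : x ∈ O n
      · simp only [T, a, hx, if_true, smul_eq_mul]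
      · simp only [T, (hlO n x hx).self_of_nhds, zero_mul, zero_smul]
    rwa [hGx, ← Real.dist_eq]
  · obtain ⟨N, hN⟩ := hlN x
    have hq₀ := (hpS x 1 one_pos x (hxU x) hxS).2
    let a : ℕ → ℝ := fun n => if x ∈ O n then p (j n x) (τ n) x - F x else 0
    let q : ℕ → X →L[ℝ] ℝ := fun n =>
      if x ∈ O n then fderiv ℝ (p (j n x) (τ n)) x else fderiv ℝ (p x 1) x
    have ha : ∀ n, |a n| ≤ τ n := fun n => by
      by_cases hx : x ∈ O n
      · simp only [a, hx, if_true]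
        exact (hpS _ _ (hτ n) _ (hjU n x hx) hxS).1
      · simp only [a, hx, if_false, abs_zero]
        exact (hτ n).le
    have hq : ∀ n, q n ∈ Q x := fun n => by
      by_cases hx : x ∈ O n
      · simp only [q, hx, if_true]
        exact (hpS _ _ (hτ n) _ (hjU n x hx) hxS).2
      · simp only [q, hx, if_false]
        exact hq₀
    have hmem := (hQ x).sum_mem (t := Finset.range N) (w := fun n => l n x)
      (fun n _ => hl0 n x) hN.self_of_nhds.2 (fun n _ => hq n)
    have hld : ∀ n, HasFDerivAt (l n) (fderiv ℝ (l n) x) x := fun n =>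
      ((hl1 n).differentiable (by simp) x).hasFDerivAt
    have hTd : ∀ n, HasFDerivAt (T n)
        (l n x • q n + (a n + F x) • fderiv ℝ (l n) x) x := fun n => by
      by_cases hx : x ∈ O n
      · have hpd := ((hp1 (j n x) _ (hτ n)).differentiable (by simp) x).hasFDerivAt
        refine ((hld n).mul hpd).congr_of_eventuallyEq (hTin n x hx) |>.congr_fderiv ?_
        simp only [a, q, hx, if_true, sub_add_cancel]
      · have hl : l n =ᶠ[𝓝 x] fun _ => 0 := hlO n x hx
        refine (hasFDerivAt_const (0 : ℝ) x).congr_of_eventuallyEq (hTout n x hx)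
          |>.congr_fderiv ?_
        rw [hl.fderiv_eq, hl.self_of_nhds]
        simp
    have hGd : HasFDerivAt G (∑ n ∈ Finset.range N,
        (l n x • q n + (a n + F x) • fderiv ℝ (l n) x)) x :=
      (HasFDerivAt.fun_sum fun n _ => hTd n).congr_of_eventuallyEq (hGloc x N hN)
    -- The weights sum to one locally, so the number `F x` drops out and `F` need not be
    -- differentiable.
    have hl' : ∑ n ∈ Finset.range N, fderiv ℝ (l n) x = 0 := by
      have h1 : HasFDerivAt (fun z => ∑ n ∈ Finset.range N, l n z)
          (∑ n ∈ Finset.range N, fderiv ℝ (l n) x) x := HasFDerivAt.fun_sum fun n _ => hld n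
      refine h1.unique ((hasFDerivAt_const (1 : ℝ) x).congr_of_eventuallyEq ?_)
      filter_upwards [hN] with z hz using hz.2
    refine ⟨_, hmem, ?_⟩
    have hdiff : fderiv ℝ G x - ∑ n ∈ Finset.range N, l n x • q n =
        ∑ n ∈ Finset.range N, a n • fderiv ℝ (l n) x := by
      rw [hGd.fderiv]
      simp only [add_smul, Finset.sum_add_distrib, ← Finset.smul_sum, hl', smul_zero, add_zero,
        add_sub_cancel_left]
    rw [hdiff]
    calc ‖∑ n ∈ Finset.range N, a n • fderiv ℝ (l n) x‖
        ≤ ∑ n ∈ Finset.range N, ε / 2 * (1 / 2) ^ n := by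
          refine norm_sum_le_of_le _ fun n _ => ?_
          rw [norm_smul, Real.norm_eq_abs]
          exact (mul_le_mul (ha n) (hM n x) (norm_nonneg _) (hτ n).le).trans (hτM n)
      _ = ε / 2 * ∑ n ∈ Finset.range N, (1 / 2) ^ n := by rw [Finset.mul_sum]
      _ ≤ ε / 2 * 2 := mul_le_mul_of_nonneg_left (sum_geometric_two_le N) (by positivity)
      _ = ε := by ring

end Gluing

/-! ### Approximation along a closed subspace -/

section Extension

variable {X : Type*} [NormedAddCommGroup X] [NormedSpace ℝ X]

theorem convex_setOf_norm_comp_subtypeL_sub_le (Y : Submodule ℝ X) (v : Y →L[ℝ] ℝ) (r : ℝ) :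
    Convex ℝ {ℓ : X →L[ℝ] ℝ | ‖ℓ.comp Y.subtypeL - v‖ ≤ r} := by
  have hlin : IsLinearMap ℝ fun ℓ : X →L[ℝ] ℝ => ℓ.comp Y.subtypeL :=
    ⟨fun _ _ => rfl, fun _ _ => rfl⟩
  have h := (convex_closedBall v r).is_linear_preimage hlin
  simpa only [preimage, Metric.mem_closedBall, dist_eq_norm] using h

theorem convex_setOf_norm_le (R : ℝ) : Convex ℝ {ℓ : X →L[ℝ] ℝ | ‖ℓ‖ ≤ R} := by
  simpa only [Metric.closedBall, dist_zero_right] using convex_closedBall (0 : X →L[ℝ] ℝ) R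

theorem norm_comp_subtypeL_sub_le_add {Y : Submodule ℝ X} {ℓ q : X →L[ℝ] ℝ} {v : Y →L[ℝ] ℝ}
    {a b : ℝ} (h₁ : ‖ℓ - q‖ ≤ a) (h₂ : ‖q.comp Y.subtypeL - v‖ ≤ b) :
    ‖ℓ.comp Y.subtypeL - v‖ ≤ a + b := by
  have h : ℓ.comp Y.subtypeL - v = (ℓ - q).comp Y.subtypeL + (q.comp Y.subtypeL - v) := by
    ext u
    simp
  rw [h]
  refine (norm_add_le ((ℓ - q).comp Y.subtypeL) (q.comp Y.subtypeL - v)).trans (add_le_add ?_ h₂)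
  refine ((ℓ - q).opNorm_comp_le Y.subtypeL).trans ?_
  exact (mul_le_of_le_one_right (norm_nonneg _) Y.norm_subtypeL_le).trans h₁

theorem fderiv_restrict_submodule {Y : Submodule ℝ X} {G : X → ℝ} (hG : Differentiable ℝ G)
    (y : Y) :
    fderiv ℝ (fun z : Y => G (z : X)) y = (fderiv ℝ G (y : X)).comp Y.subtypeL :=
  ((hG (y : X)).hasFDerivAt.comp y Y.subtypeL.hasFDerivAt).fderiv

/-- A `C¹` function on `Y` with continuous extension `F` is approximated by a `C¹` function on `X`
whose derivative at points of `Y` is nearly an extension of the derivative of `f` of nearly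
the same norm. -/
theorem PropertyStar.exists_contDiff_approx (hX : PropertyStar X) {Y : Submodule ℝ X}
    (hY : IsClosed (Y : Set X)) {f : Y → ℝ} (hf : ContDiff ℝ 1 f) {F : X → ℝ}
    (hF : Continuous F) (hFf : ∀ y : Y, F (y : X) = f y) {ε : ℝ} (hε : 0 < ε) :
    ∃ G : X → ℝ, ContDiff ℝ 1 G ∧ (∀ x, |G x - F x| < ε) ∧
      ∀ y : Y, ‖(fderiv ℝ G (y : X)).comp Y.subtypeL - fderiv ℝ f y‖ ≤ ε ∧
        ‖fderiv ℝ G (y : X)‖ ≤ ‖fderiv ℝ f y‖ + ε := by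
  obtain ⟨C₀, hC⟩ := hX.exists_approx
  have hfd : Differentiable ℝ f := hf.differentiable (by simp)
  have hf' : Continuous (fderiv ℝ f) := hf.continuous_fderiv (by simp)
  let Q : X → Set (X →L[ℝ] ℝ) := fun z => {ℓ | ∀ y : Y, (y : X) = z →
    ‖ℓ.comp Y.subtypeL - fderiv ℝ f y‖ ≤ ε / 2 ∧ ‖ℓ‖ ≤ ‖fderiv ℝ f y‖ + ε / 2}
  have hQ : ∀ z, Convex ℝ (Q z) := by
    intro z
    simp only [Q, ofPred_forall, ofPred_and]
    exact convex_iInter₂ fun y _ => (convex_setOf_norm_comp_subtypeL_sub_le Y _ _).inter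
      (convex_setOf_norm_le _)
  refine (hX.exists_contDiff_glue (F := F) (S := (Y : Set X)) hQ (half_pos hε) ?_).elim ?_
  swap
  · rintro G ⟨hG1, hGF, hGY⟩
    refine ⟨G, hG1, fun x => (hGF x).trans (half_lt_self hε), fun y => ?_⟩
    obtain ⟨q, hq, hqG⟩ := hGY y y.2
    obtain ⟨h1, h2⟩ := hq y rfl
    constructor
    · exact (norm_comp_subtypeL_sub_le_add hqG h1).trans_eq (add_halves ε)
    · have := norm_le_norm_add_norm_sub' (fderiv ℝ G (y : X)) q
      linarith
  intro x
  by_cases hx : x ∈ Y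
  swap
  · refine ⟨(Y : Set X)ᶜ ∩ {z | |F x - F z| < ε / 2}, hY.isOpen_compl.inter ?_, ⟨hx, ?_⟩,
      fun τ hτ => ⟨fun _ => F x, contDiff_const, fun z hz => hz.2, fun z hz hzY =>
        absurd hzY hz.1⟩⟩
    · exact isOpen_lt (by fun_prop) continuous_const
    · simpa using hε
  let y : Y := ⟨x, hx⟩
  let δ : ℝ≥0 := Real.toNNReal (ε / 2 / (1 + C₀))
  have hδ' : (δ : ℝ) = ε / 2 / (1 + C₀) := Real.coe_toNNReal _ (by positivity)
  have hδ : (0 : ℝ) < δ := by rw [hδ']; positivity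
  have hδC : (δ : ℝ) + C₀ * δ = ε / 2 := by
    rw [hδ']
    field_simp
  obtain ⟨T, hT, hTn⟩ := exists_extension_norm_eq Y (fderiv ℝ f y)
  obtain ⟨r, hr, hball⟩ := (Metric.continuousAt_iff (f := fderiv ℝ f) (a := y)).1
    hf'.continuousAt δ hδ
  have hlipY : LipschitzOnWith δ (fun z : Y => f z - T z) (Metric.ball y r) := by
    have hd : ∀ z : Y, HasFDerivAt (fun z : Y => f z - T z)
        (fderiv ℝ f z - fderiv ℝ f y) z := fun z => by
      refine ((hfd z).hasFDerivAt.sub (T.comp Y.subtypeL).hasFDerivAt).congr_fderiv ?_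
      congr 1
      ext v
      exact hT v
    refine (convex_ball y r).lipschitzOnWith_of_nnnorm_hasFDerivWithin_le
      (fun z _ => (hd z).hasFDerivWithinAt) fun z hz => ?_
    rw [← NNReal.coe_le_coe, coe_nnnorm, ← dist_eq_norm]
    exact (hball hz).le
  have hlip : LipschitzOnWith δ (fun z : X => F z - T z) ((Y : Set X) ∩ Metric.ball x r) := by
    refine LipschitzOnWith.of_dist_le_mul fun z hz z' hz' => ?_
    have := hlipY.dist_le_mul ⟨z, hz.1⟩ hz.2 ⟨z', hz'.1⟩ hz'.2
    rw [← hFf, ← hFf] at this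
    exact this
  obtain ⟨e, he, heq⟩ := hlip.extend_real
  have hex : T x + e x - F x = 0 := by
    have := heq ⟨hx, Metric.mem_ball_self hr⟩
    simp only at this
    linarith
  -- `T + e` equals `F` only on `Y` inside the ball; elsewhere it is within `ε / 4` by continuity,
  -- and smoothing `e` costs another `ε / 4`.
  refine ⟨Metric.ball x r ∩ {z | |T z + e z - F z| < ε / 4},
    Metric.isOpen_ball.inter (isOpen_lt ?_ continuous_const),
    ⟨Metric.mem_ball_self hr, by rw [mem_ofPred_eq, hex]; simpa using hε⟩, fun τ hτ => ?_⟩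
  · have := he.continuous
    fun_prop
  obtain ⟨K, hK1, hKe, hKL⟩ := hC e δ he (min τ (ε / 4)) (lt_min hτ (by positivity))
  have hKd : Differentiable ℝ K := hK1.differentiable (by simp)
  refine ⟨fun z => T z + K z, T.contDiff.add hK1, fun z hz => ?_, fun z hz hzY => ⟨?_, ?_⟩⟩
  · have h1 := (hKe z).trans_le (min_le_right _ _)
    have h2 := hz.2
    rw [mem_ofPred_eq] at h2
    rw [abs_lt] at h1 h2 ⊢
    constructor <;> linarith
  · have h1 := (hKe z).trans_le (min_le_left _ _)
    have h2 := heq ⟨hzY, hz.1⟩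
    simp only at h2
    have h3 : T z + K z - F z = K z - e z := by linarith
    rw [h3]
    exact h1.le
  · have hK' : ‖fderiv ℝ K z‖ ≤ C₀ * δ := by
      simpa using norm_fderiv_le_of_lipschitz ℝ hKL (x₀ := z)
    have hder : fderiv ℝ (fun z => T z + K z) z = T + fderiv ℝ K z :=
      (T.hasFDerivAt.add (hKd z).hasFDerivAt).fderiv
    rintro v rfl
    rw [hder]
    have hfv : ‖fderiv ℝ f y - fderiv ℝ f v‖ ≤ δ := by
      rw [← dist_eq_norm (fderiv ℝ f y) (fderiv ℝ f v), dist_comm]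
      exact (hball hz.1).le
    have hTY : T.comp Y.subtypeL = fderiv ℝ f y := by
      ext u
      exact hT u
    constructor
    · rw [← hδC, add_comm (δ : ℝ)]
      refine norm_comp_subtypeL_sub_le_add (q := T) ?_ ?_
      · rwa [add_sub_cancel_left]
      · rwa [hTY]
    · have h1 := norm_le_norm_add_norm_sub' (fderiv ℝ f y) (fderiv ℝ f v)
      have h2 := norm_add_le T (fderiv ℝ K v)
      linarith

theorem exists_lipschitz_cutoff {α : Type*} [PseudoMetricSpace α] {W : Set α} (hW : IsOpen W)
    {L : ℝ≥0} (hL : 0 < L) {δ : ℝ} (hδ : 0 < δ) :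
    ∃ κ : α → ℝ, LipschitzWith L κ ∧ (∀ x, 0 ≤ κ x) ∧ (∀ x, κ x ≤ δ) ∧
      ∀ x, 0 < κ x ↔ x ∈ W := by
  -- `Metric.infDist` to the empty set is zero, so `W = univ` needs a constant.
  rcases (Wᶜ).eq_empty_or_nonempty with h | h
  · refine ⟨fun _ => δ, (LipschitzWith.const δ).weaken (by simp), fun _ => hδ.le, fun _ => le_rfl,
      fun x => ?_⟩
    simp [hδ, compl_empty_iff.1 h]
  · refine ⟨fun x => min (L * Metric.infDist x Wᶜ) δ, ?_, fun x => ?_, fun x => min_le_right _ _,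
      fun x => ?_⟩
    · refine LipschitzWith.min_const ?_ δ
      refine LipschitzWith.of_dist_le_mul fun x y => ?_
      have := (Metric.lipschitz_infDist_pt Wᶜ).dist_le_mul x y
      rw [Real.dist_eq] at this ⊢
      rw [← mul_sub, abs_mul, NNReal.abs_eq]
      simp only [NNReal.coe_one, one_mul] at this
      exact mul_le_mul_of_nonneg_left this L.2
    · exact le_min (mul_nonneg L.2 Metric.infDist_nonneg) hδ.le
    · rw [lt_min_iff, mul_pos_iff_of_pos_left (by exact_mod_cast hL),
        ← hW.isClosed_compl.notMem_iff_infDist_pos h, notMem_compl_iff]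
      exact and_iff_left hδ

/-- Clamping `G` to a band of width `κ` around a Lipschitz function `F` gives a Lipschitz function
if the derivative of `G` is bounded where the band is nondegenerate. -/
theorem lipschitzWith_clamp {W : Set X} {F κ G : X → ℝ} {L L' K : ℝ≥0}
    (hF : LipschitzWith L F) (hκ : LipschitzWith L' κ) (hκ0 : ∀ x, 0 ≤ κ x)
    (hκW : ∀ x, x ∉ W → κ x = 0) (hG : Differentiable ℝ G)
    (hGW : ∀ x ∈ W, ‖fderiv ℝ G x‖ ≤ K) (hK : L + L' ≤ K) :
    LipschitzWith K (fun x => max (F x - κ x) (min (G x) (F x + κ x))) := by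
  have hKr : (L : ℝ) + L' ≤ K := by exact_mod_cast hK
  refine LipschitzWith.of_dist_le_mul fun x y => ?_
  have hFxy := fun x y => hF.dist_le_mul x y
  have hκxy := fun x y => hκ.dist_le_mul x y
  simp only [Real.dist_eq] at hFxy hκxy ⊢
  by_cases hseg : segment ℝ x y ⊆ W
  · have h1 : |G x - G y| ≤ K * dist x y := by
      rw [dist_eq_norm]
      exact (convex_segment x y).norm_image_sub_le_of_norm_fderiv_le (fun z _ => hG z)
        (fun z hz => hGW z (hseg hz)) (right_mem_segment ℝ x y) (left_mem_segment ℝ x y)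
    have hKd : (L : ℝ) * dist x y + L' * dist x y ≤ K * dist x y := by
      rw [← add_mul]
      exact mul_le_mul_of_nonneg_right hKr dist_nonneg
    have hF' := abs_le.1 (hFxy x y)
    have hκ' := abs_le.1 (hκxy x y)
    refine (abs_max_sub_max_le_max _ _ _ _).trans (max_le ?_ ?_)
    · rw [abs_le]
      constructor <;> linarith
    · refine (abs_min_sub_min_le_max _ _ _ _).trans (max_le h1 ?_)
      rw [abs_le]
      constructor <;> linarith
  -- At `z` the band has width zero, so both endpoints are compared with `F z`; distances add along
  -- the segment.
  · obtain ⟨z, hz, hzW⟩ := not_subset.1 hseg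
    have key : ∀ u, |max (F u - κ u) (min (G u) (F u + κ u)) - F z| ≤ K * dist u z := fun u => by
      have h1 := abs_le.1 (hFxy u z)
      have h2 := abs_le.1 (hκxy u z)
      rw [hκW z hzW] at h2
      have hKd : (L : ℝ) * dist u z + L' * dist u z ≤ K * dist u z := by
        rw [← add_mul]
        exact mul_le_mul_of_nonneg_right hKr dist_nonneg
      have h3 : F u - κ u ≤ max (F u - κ u) (min (G u) (F u + κ u)) := le_max_left _ _
      have h4 : max (F u - κ u) (min (G u) (F u + κ u)) ≤ F u + κ u :=
        max_le (by linarith [hκ0 u]) (min_le_right _ _)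
      rw [abs_le]
      constructor <;> linarith
    refine (abs_sub_le _ (F z) _).trans ?_
    rw [abs_sub_comm (F z), ← dist_add_dist_of_mem_segment hz, mul_add, dist_comm z y]
    exact add_le_add (key x) (key y)

/-- The Lipschitz version of `PropertyStar.exists_contDiff_approx`. -/
theorem PropertyStar.exists_lipschitz_contDiff_approx (hX : PropertyStar X) :
    ∃ C : ℝ≥0, ∀ (Y : Submodule ℝ X), IsClosed (Y : Set X) → ∀ f : Y → ℝ, ContDiff ℝ 1 f →
      ∀ (F : X → ℝ) (L : ℝ≥0), 0 < L → LipschitzWith L F → (∀ y : Y, F (y : X) = f y) →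
      ∀ ε : ℝ, 0 < ε → ∃ G : X → ℝ, ContDiff ℝ 1 G ∧ (∀ x, |G x - F x| < ε) ∧
        (∀ y : Y, ‖(fderiv ℝ G (y : X)).comp Y.subtypeL - fderiv ℝ f y‖ < ε) ∧
        LipschitzWith (C * L) G := by
  obtain ⟨C₀, hC⟩ := hX.exists_approx
  -- `3 * C₀` comes from smoothing the clamped function, `3` from `G₁`, and `1` from the gluing
  -- error `δ ≤ L`.
  refine ⟨3 * C₀ + 4, fun Y hY f hf F L hL hF hFf ε hε => ?_⟩
  have hLr : (0 : ℝ) < L := by exact_mod_cast hL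
  let δ : ℝ≥0 := min (Real.toNNReal (ε / 4)) L
  have hδ : (0 : ℝ) < δ := by
    have : 0 < δ := lt_min (Real.toNNReal_pos.2 (by positivity)) hL
    exact_mod_cast this
  have hδε : (δ : ℝ) ≤ ε / 4 := by
    rw [← Real.coe_toNNReal (ε / 4) (by positivity)]
    exact_mod_cast min_le_left _ _
  have hδL : δ ≤ L := min_le_right _ _
  have hδLr : (δ : ℝ) ≤ L := by exact_mod_cast hδL
  obtain ⟨G₁, hG1, hG1F, hG1Y⟩ := hX.exists_contDiff_approx hY hf hF.continuous hFf hδ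
  have hG1d : Differentiable ℝ G₁ := hG1.differentiable (by simp)
  have hfd : Differentiable ℝ f := hf.differentiable (by simp)
  have hfL : ∀ y, ‖fderiv ℝ f y‖ ≤ L := fun y => by
    have : LipschitzWith L f := LipschitzWith.of_dist_le_mul fun y y' => by
      rw [← hFf, ← hFf]
      exact hF.dist_le_mul y y'
    exact norm_fderiv_le_of_lipschitz ℝ this
  let W : Set X := {x | ‖fderiv ℝ G₁ x‖ < 3 * L}
  have hW : IsOpen W := isOpen_lt (hG1.continuous_fderiv (by simp)).norm continuous_const
  have hYW : ∀ y : Y, (y : X) ∈ W := fun y => by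
    change ‖fderiv ℝ G₁ (y : X)‖ < 3 * L
    linarith [(hG1Y y).2, hfL y]
  obtain ⟨κ, hκL, hκ0, hκδ, hκW⟩ := exists_lipschitz_cutoff hW hL hδ
  obtain ⟨e, heL, heδ, heY⟩ : ∃ e : X → ℝ, LipschitzWith δ e ∧ (∀ x, |e x| ≤ δ) ∧
      ∀ x ∈ Y, e x = G₁ x - F x := by
    have hd : ∀ z : Y, HasFDerivAt (fun z : Y => G₁ z - f z)
        ((fderiv ℝ G₁ (z : X)).comp Y.subtypeL - fderiv ℝ f z) z := fun z =>
      ((hG1d (z : X)).hasFDerivAt.comp z Y.subtypeL.hasFDerivAt).sub (hfd z).hasFDerivAt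
    have hlipY : LipschitzOnWith δ (fun z : Y => G₁ z - f z) univ :=
      convex_univ.lipschitzOnWith_of_nnnorm_hasFDerivWithin_le
        (fun z _ => (hd z).hasFDerivWithinAt) fun z _ => by
          rw [← NNReal.coe_le_coe, coe_nnnorm]
          exact (hG1Y z).1
    have hlip : LipschitzOnWith δ (fun z : X => G₁ z - F z) (Y : Set X) := by
      refine LipschitzOnWith.of_dist_le_mul fun z hz z' hz' => ?_
      have := hlipY.dist_le_mul ⟨z, hz⟩ (mem_univ _) ⟨z', hz'⟩ (mem_univ _)
      rw [← hFf, ← hFf] at this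
      exact this
    obtain ⟨e, he, heq⟩ := hlip.extend_real
    -- Truncation changes nothing on `Y`, where `G₁ - F` is already smaller than `δ`.
    refine ⟨fun x => max (-δ) (min (e x) δ), (he.min_const δ).const_max (-δ), fun x => ?_,
      fun x hx => ?_⟩
    · exact abs_le.2 ⟨le_max_left _ _, max_le (by linarith) (min_le_right _ _)⟩
    · have h := abs_lt.1 (hG1F x)
      have h' : e x = G₁ x - F x := (heq hx).symm
      simp only [h']
      rw [min_eq_left h.2.le, max_eq_right h.1.le]
  have hF' : LipschitzWith (L + δ) (fun x => F x + e x) := hF.add heL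
  let F₂ : X → ℝ := fun x => max (F x + e x - κ x) (min (G₁ x) (F x + e x + κ x))
  have hF₂ : LipschitzWith (3 * L) F₂ := by
    refine lipschitzWith_clamp (W := W) hF' hκL hκ0 (fun x hx => ?_) hG1d (fun x hx => ?_) ?_
    · exact le_antisymm (not_lt.1 fun h => hx ((hκW x).1 h)) (hκ0 x)
    · exact_mod_cast le_of_lt hx
    · rw [← NNReal.coe_le_coe]
      push_cast
      linarith
  have hF₂F : ∀ x, |F₂ x - F x| ≤ 2 * δ := fun x => by
    have h1 := abs_le.1 (heδ x)
    have h2 := hκδ x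
    have h3 : F x + e x - κ x ≤ F₂ x := le_max_left _ _
    have h4 : F₂ x ≤ F x + e x + κ x := max_le (by linarith [hκ0 x]) (min_le_right _ _)
    rw [abs_le]
    constructor <;> linarith
  -- Here the clamp is inactive. `V` contains `Y`, since `F + e = G₁` and `κ > 0` there.
  let V : Set X := {z | |G₁ z - (F z + e z)| < κ z}
  have hV : IsOpen V := by
    have h1 := hF.continuous
    have h2 := heL.continuous
    have h3 := hG1.continuous
    exact isOpen_lt (by fun_prop) hκL.continuous
  have hVF₂ : ∀ z ∈ V, F₂ z = G₁ z := fun z hz => by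
    have h := abs_lt.1 (show |G₁ z - (F z + e z)| < κ z from hz)
    simp only [F₂]
    rw [min_eq_left (by linarith), max_eq_right (by linarith)]
  have hVW : ∀ z ∈ V, z ∈ W := fun z hz => (hκW z).1 ((abs_nonneg _).trans_lt hz)
  let Q : X → Set (X →L[ℝ] ℝ) := fun z => {ℓ | ‖ℓ‖ ≤ (3 * C₀ + 3) * L ∧ ∀ y : Y, (y : X) = z →
    ‖ℓ.comp Y.subtypeL - fderiv ℝ f y‖ ≤ δ}
  have hQ : ∀ z, Convex ℝ (Q z) := by
    intro z
    simp only [Q, ofPred_forall, ofPred_and]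
    exact (convex_setOf_norm_le _).inter
      (convex_iInter₂ fun y _ => convex_setOf_norm_comp_subtypeL_sub_le Y _ _)
  refine (hX.exists_contDiff_glue (F := F₂) (S := univ) hQ hδ ?_).elim ?_
  swap
  · rintro G ⟨hG, hGF, hGQ⟩
    have hGd : Differentiable ℝ G := hG.differentiable (by simp)
    refine ⟨G, hG, fun x => ?_, fun y => ?_, ?_⟩
    · have := (abs_sub_le (G x) (F₂ x) (F x)).trans (add_le_add (hGF x).le (hF₂F x))
      linarith
    · obtain ⟨q, hq, hqG⟩ := hGQ y (mem_univ _)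
      exact (norm_comp_subtypeL_sub_le_add hqG (hq.2 y rfl)).trans_lt (by linarith)
    · refine lipschitzWith_of_nnnorm_fderiv_le hGd fun x => ?_
      obtain ⟨q, hq, hqG⟩ := hGQ x (mem_univ _)
      rw [← NNReal.coe_le_coe]
      push_cast
      have h1 := norm_le_norm_add_norm_sub' (fderiv ℝ G x) q
      have h2 : ‖q‖ ≤ (3 * C₀ + 3) * L := hq.1
      linarith
  intro x
  have hC₀L : (0 : ℝ) ≤ C₀ * L := by positivity
  by_cases hx : x ∈ Y
  -- `G₁` has zero error on `V`, so a single piece serves every `τ`.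
  · refine ⟨V, hV, ?_, fun τ hτ => ⟨G₁, hG1, fun z hz => ?_, fun z hz _ => ⟨?_, ?_, ?_⟩⟩⟩
    · change |G₁ x - (F x + e x)| < κ x
      rw [heY x hx, add_sub_cancel, sub_self, abs_zero]
      exact (hκW x).2 (hYW ⟨x, hx⟩)
    · rw [hVF₂ z hz, sub_self, abs_zero]
      exact hδ
    · rw [hVF₂ z hz, sub_self, abs_zero]
      exact hτ.le
    · have : ‖fderiv ℝ G₁ z‖ < 3 * L := hVW z hz
      linarith
    · rintro y rfl
      exact (hG1Y y).1
  · refine ⟨(Y : Set X)ᶜ, hY.isOpen_compl, hx, fun τ hτ => ?_⟩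
    obtain ⟨K, hK1, hKF, hKL⟩ := hC F₂ (3 * L) hF₂ (min τ δ) (lt_min hτ hδ)
    refine ⟨K, hK1, fun z _ => (hKF z).trans_le (min_le_right _ _), fun z hz _ =>
      ⟨((hKF z).trans_le (min_le_left _ _)).le, ?_, fun y hy => absurd (hy ▸ y.2) hz⟩⟩
    have h := norm_fderiv_le_of_lipschitz ℝ hKL (x₀ := z)
    push_cast at h
    linarith

end Extension

theorem mainTheorem4 {X : Type*} [NormedAddCommGroup X] [NormedSpace ℝ X] [CompleteSpace X]
    (hX : PropertyStar X) :
    ∃ C₂ : ℝ≥0, ∀ (Y : Submodule ℝ X), IsClosed (Y : Set X) →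
      ∀ (f : Y → ℝ), ContDiff ℝ 1 f →
      ∀ (F : X → ℝ), Continuous F → (∀ y : Y, F (y : X) = f y) →
      ∀ ε : ℝ, 0 < ε →
        (∃ G : X → ℝ, ContDiff ℝ 1 G ∧
          (∀ x : X, |F x - G x| < ε) ∧
          (∀ y : Y, ‖fderiv ℝ f y - fderiv ℝ (fun z : Y => G (z : X)) y‖ < ε)) ∧
        (IsLipschitz f → IsLipschitz F →
          ∃ G : X → ℝ, ContDiff ℝ 1 G ∧
            (∀ x : X, |F x - G x| < ε) ∧
            (∀ y : Y, ‖fderiv ℝ f y - fderiv ℝ (fun z : Y => G (z : X)) y‖ < ε) ∧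
            IsLipschitz G ∧ lipConst G ≤ C₂ * lipConst F) := by
  obtain ⟨C, hC⟩ := hX.exists_lipschitz_contDiff_approx
  refine ⟨C, fun Y hY f hf F hF hFf ε hε => ⟨?_, fun _ hFL => ?_⟩⟩
  · obtain ⟨G, hG, hGF, hGY⟩ := hX.exists_contDiff_approx hY hf hF hFf (half_pos hε)
    refine ⟨G, hG, fun x => ?_, fun y => ?_⟩
    · rw [abs_sub_comm]
      exact (hGF x).trans (half_lt_self hε)
    · rw [fderiv_restrict_submodule (hG.differentiable (by simp)),
        norm_sub_rev (fderiv ℝ f y) ((fderiv ℝ G (y : X)).comp Y.subtypeL)]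
      exact (hGY y).1.trans_lt (half_lt_self hε)
  · have hL := hFL.lipschitzWith_lipConst
    -- With constant zero there is no slack for the gluing error, but `F` is constant and serves as
    -- `G`.
    rcases (zero_le : 0 ≤ lipConst F).eq_or_lt with h0 | h0
    · have hconst : ∀ x, F x = F 0 := fun x => by
        have := hL.dist_le_mul x 0
        rw [← h0, NNReal.coe_zero, zero_mul] at this
        exact dist_le_zero.1 this
      have hF1 : ContDiff ℝ 1 F := by
        rw [show F = fun _ => F 0 from funext hconst]
        exact contDiff_const
      have hfF : f = fun z : Y => F (z : X) := funext fun y => (hFf y).symm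
      refine ⟨F, hF1, fun x => by simpa using hε, fun y => ?_, hFL, ?_⟩
      · rw [hfF, sub_self]
        exact (norm_zero (E := Y →L[ℝ] ℝ)).trans_lt hε
      · rw [← h0, mul_zero]
    · obtain ⟨G, hG, hGF, hGY, hGL⟩ := hC Y hY f hf F _ h0 hL hFf ε hε
      refine ⟨G, hG, fun x => ?_, fun y => ?_, ⟨_, hGL⟩, lipConst_le hGL⟩
      · rw [abs_sub_comm]
        exact hGF x
      · rw [fderiv_restrict_submodule (hG.differentiable (by simp)),
          norm_sub_rev (fderiv ℝ f y) ((fderiv ℝ G (y : X)).comp Y.subtypeL)]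
        exact hGY y
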